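/- Consider the operational TSO model with processes $1,\dots,n$, $n\ge 2$, and finitely many shared variables. Each process $i$ has a FIFO store buffer, emptied by a local dispatcher $d_i$, whose action $\mathtt{prop}$ writes the oldest buffered item to memory. Processes perform reads (answered from the own buffer if it holds the variable, otherwise from memory), writes (appended to the buffer), fences $\mathtt F$ (enabled only when the own buffer is empty), read-modify-writes $\mathtt{RMW}(x,v_{exp},v_{new})$ (enabled only when the own buffer is empty and $x=v_{exp}$ in memory), internal actions, and responses to operations; the environment invokes operations. The local state of a process is the history of its invocations, actions and values read. In a run, an enabled, conflict-free joint action of all agents takes place in each round, the processes act according to a (possibly nondeterministic) protocol, which maps local states to nonempty sets of actions, and no operation is invoked at a process whose previous operation is pending. A run is fair if every buffered item is eventually propagated and no process stops moving forever while it continuously has an enabled action to perform. A snapshot object over a set $W$ stores a vector in $(W\cup\{\bot\})^n$, initially $(\bot,\dots,\bot)$ with $\bot\notin W$; $\mathrm{update}_j(w)$, $w\in W$, sets component $j$ to $w$ and $\mathrm{scan}_i$ returns the vector. By convention, in every run each process is asked to write each value at most once. An implementation (a protocol with initial memory contents) is linearizable if the history of every finite prefix of a run is linearizable with respect to this object.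 It is obstruction-free if a process with a pending operation completes it whenever, from some time on, no other process takes steps, the process itself is scheduled fairly and buffered items are eventually propagated. An operation $X$ invoked at a process in round $t+1$ and returning in round $t'$ has start $t_{X.s}=t$ and end $t_{X.e}=t'$; write $X<_rY$ if $t_{X.e}<t_{Y.s}$ in $r$. It runs solo, when performed by $i$, if only $i$ and $d_i$ take actions between its start and its end. Theorem. Let $\mathcal I$ be an obstruction-free linearizable snapshot implementation in TSO for $n\ge 2$ processes. Let $r$ be a run of $\mathcal I$ in which an operation $\mathrm{scan}_i$ is performed by process $i$ running solo and completes, and suppose that $\mathrm{scan}_i$ contains neither $\mathtt F$ nor $\mathtt{RMW}$ actions in $r$. Then for every process $j$ and every $v\in W$ such that $\mathrm{update}_j(v)$ has not been invoked in $r$ by the end of $\mathrm{scan}_i$, there is a fair run $\tilde r$ of $\mathcal I$ such that $\tilde r$ is indistinguishable to $i$ from $r$ until the end of $\mathrm{scan}_i$ (process $i$ has the same local states in $\tilde r$ and $r$ at all times up to $t_{\mathrm{scan}_i.e}$), $\mathrm{scan}_i<_{\tilde r}\mathrm{update}_j(v)$, and $\mathrm{update}_j(v)$ completes in $\tilde r$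 and contains an $\mathtt F$ or $\mathtt{RMW}$ action. -/

import Mathlib

namespace TSO

open Classical in
/-- The pending value of `x` in a store buffer: the latest (rightmost) entry for `x`, if any. -/
noncomputable def bufLookup {Var Val : Type*} (β : List (Var × Val)) (x : Var) : Option Val :=
  ((β.filter (fun p => p.1 = x)).getLast?).map Prod.snd

/-- A basic TSO state: main memory, and a store buffer (oldest entry first) for each process. -/
structure MemState (n : ℕ) (Var Val : Type*) where
  mem : Var → Val
  buf : Fin n → List (Var × Val)

/-- The actions of a process. `internal a` and `ret y` (the response, with value `y`, to the pending
operation) do not touch the TSO state; `null` is the null action. -/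
inductive Act (Var Val Intl Resp : Type*) where
  | null
  | read (x : Var)
  | write (x : Var) (v : Val)
  | fence
  | rmw (x : Var) (vexp vnew : Val)
  | internal (a : Intl)
  | ret (y : Resp)

/-- The records that make up local states. A read record does not show whether the value came from
the buffer or from memory. -/
inductive Rec (Var Val Intl Op Resp : Type*) where
  | read (x : Var) (v : Val)
  | write (x : Var) (v : Val)
  | fence
  | rmw (x : Var) (vexp vnew : Val)
  | internal (a : Intl)
  | ret (y : Resp)
  | invoke (o : Op)

/-- The local state of a process is the history of its records, oldest first. -/
abbrev LocalState (Var Val Intl Op Resp : Type*) := List (Rec Var Val Intl Op Resp)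

/-- An operation is pending if the last invocation has not been followed by a response. -/
def LocalState.Pending {Var Val Intl Op Resp : Type*} (l : LocalState Var Val Intl Op Resp) : Prop :=
  ∃ (l₁ : List (Rec Var Val Intl Op Resp)) (o : Op) (l₂ : List (Rec Var Val Intl Op Resp)),
    l = l₁ ++ Rec.invoke o :: l₂ ∧ ∀ y : Resp, Rec.ret y ∉ l₂

/-- A global state. -/
structure GlobalState (n : ℕ) (Var Val Intl Op Resp : Type*) where
  tso : MemState n Var Val
  loc : Fin n → LocalState Var Val Intl Op Resp

/-- A joint action: an action for each process, whether each local dispatcher propagates, and at most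
one invocation by the environment for each process. -/
structure JointAction (n : ℕ) (Var Val Intl Op Resp : Type*) where
  act : Fin n → Act Var Val Intl Resp
  prop : Fin n → Bool
  inv : Fin n → Option Op

/-- The agents: processes and their local dispatchers. -/
inductive Agent (n : ℕ) where
  | proc (i : Fin n)
  | disp (i : Fin n)

section Semantics

variable {n : ℕ} {Var Val Intl Op Resp : Type*}

/-- The value returned by a read of `x` by process `i`: from the buffer if possible, otherwise from
memory. -/
noncomputable def MemState.readVal (σ : MemState n Var Val) (i : Fin n) (x : Var) : Val :=
  (bufLookup (σ.buf i) x).getD (σ.mem x)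

/-- Preconditions of process actions. -/
def MemState.Enabled (σ : MemState n Var Val) (i : Fin n) : Act Var Val Intl Resp → Prop
  | .fence => σ.buf i = []
  | .rmw x vexp _ => σ.buf i = [] ∧ σ.mem x = vexp
  | _ => True

open Classical in
/-- Effect of an action of process `i` on the TSO state. -/
noncomputable def MemState.doAct (σ : MemState n Var Val) (i : Fin n) :
    Act Var Val Intl Resp → MemState n Var Val
  | .write x v => { σ with buf := Function.update σ.buf i (σ.buf i ++ [(x, v)]) }
  | .rmw x _ vnew => { σ with mem := Function.update σ.mem x vnew }
  | _ => σ

open Classical in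
/-- Effect of a propagation by the local dispatcher of `i`. -/
noncomputable def MemState.doProp (σ : MemState n Var Val) (i : Fin n) : MemState n Var Val :=
  match σ.buf i with
  | [] => σ
  | (x, v) :: β => { mem := Function.update σ.mem x v, buf := Function.update σ.buf i β }

/-- The records added to the local state of `i` by its action in the TSO state `σ`. -/
noncomputable def MemState.record (σ : MemState n Var Val) (i : Fin n) :
    Act Var Val Intl Resp → List (Rec Var Val Intl Op Resp)
  | .null => []
  | .read x => [.read x (σ.readVal i x)]
  | .write x v => [.write x v]
  | .fence => [.fence]
  | .rmw x vexp vnew => [.rmw x vexp vnew]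
  | .internal a => [.internal a]
  | .ret y => [.ret y]

/-- Process `i` performs a read of `x` from memory. -/
def ReadsMem (σ : MemState n Var Val) (a : JointAction n Var Val Intl Op Resp) (i : Fin n) (x : Var) :
    Prop :=
  a.act i = .read x ∧ bufLookup (σ.buf i) x = none

/-- Agent `b` performs a memory access of `x`. -/
def Accesses (σ : MemState n Var Val) (a : JointAction n Var Val Intl Op Resp) :
    Agent n → Var → Prop
  | .proc i, x => (∃ vexp vnew, a.act i = .rmw x vexp vnew) ∨ ReadsMem σ a i x
  | .disp i, x => a.prop i = true ∧ ∃ v β, σ.buf i = (x, v) :: β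

/-- The actions of agents `b` and `c` conflict: both access the same variable, not both are reads
from memory, and they are not a propagation by the dispatcher of a process and a read from memory
by that same process. -/
def Conflict (σ : MemState n Var Val) (a : JointAction n Var Val Intl Op Resp) (b c : Agent n) :
    Prop :=
  ∃ x, Accesses σ a b x ∧ Accesses σ a c x ∧
    ¬ (∃ i j, b = .proc i ∧ c = .proc j ∧ ReadsMem σ a i x ∧ ReadsMem σ a j x) ∧
    ¬ (∃ i, ((b = .disp i ∧ c = .proc i) ∨ (b = .proc i ∧ c = .disp i)) ∧ ReadsMem σ a i x)

/-- The TSO state after a joint action: the actions of the processes, and then those of the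
dispatchers, are performed one by one. -/
noncomputable def MemState.doJoint (σ : MemState n Var Val)
    (a : JointAction n Var Val Intl Op Resp) : MemState n Var Val :=
  let σ₁ := (List.finRange n).foldl (fun s i => s.doAct i (a.act i)) σ
  (List.finRange n).foldl (fun s i => if a.prop i then s.doProp i else s) σ₁

/-- The global state after a joint action; invocations by the environment are recorded last. -/
noncomputable def GlobalState.next (g : GlobalState n Var Val Intl Op Resp)
    (a : JointAction n Var Val Intl Op Resp) : GlobalState n Var Val Intl Op Resp where
  tso := g.tso.doJoint a
  loc i := g.loc i ++ g.tso.record i (a.act i) ++ ((a.inv i).map Rec.invoke).toList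

/-- The joint action is enabled in `g`: every action in it is, there are no conflicts, and the
environment invokes an operation at `i` only if `i` has responded to all earlier invocations. -/
structure JointAction.Enabled (a : JointAction n Var Val Intl Op Resp)
    (g : GlobalState n Var Val Intl Op Resp) : Prop where
  act : ∀ i, g.tso.Enabled i (a.act i)
  prop : ∀ i, a.prop i = true → g.tso.buf i ≠ []
  noConflict : ∀ b c, b ≠ c → ¬ Conflict g.tso a b c
  inv : ∀ i o, a.inv i = some o →
    ¬ LocalState.Pending (g.loc i ++ g.tso.record i (a.act i))

end Semantics

/-- An implementation: a nondeterministic protocol for each process (a choice of possible actions in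
each local state) and the initial contents of memory. A process responds only to a pending
operation. -/
structure Implementation (n : ℕ) (Var Val Intl Op Resp : Type*) where
  protocol : Fin n → LocalState Var Val Intl Op Resp → Set (Act Var Val Intl Resp)
  protocol_nonempty : ∀ i l, (protocol i l).Nonempty
  ret_pending : ∀ i l y, Act.ret y ∈ protocol i l → l.Pending
  init : Var → Val

/-- An infinite sequence of global states, with `step t` the joint action performed at `state t`,
that is, in round `t + 1`. -/
structure Run (n : ℕ) (Var Val Intl Op Resp : Type*) where
  state : ℕ → GlobalState n Var Val Intl Op Resp
  step : ℕ → JointAction n Var Val Intl Op Resp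

section Runs

variable {n : ℕ} {Var Val Intl Op Resp : Type*}

/-- `r` is a TSO run of the protocol of `I`, started in its initial state. -/
structure Run.IsRunOf (r : Run n Var Val Intl Op Resp) (I : Implementation n Var Val Intl Op Resp) :
    Prop where
  init_mem : (r.state 0).tso.mem = I.init
  init_buf : ∀ i, (r.state 0).tso.buf i = []
  init_loc : ∀ i, (r.state 0).loc i = []
  enabled : ∀ t, (r.step t).Enabled (r.state t)
  next : ∀ t, r.state (t + 1) = (r.state t).next (r.step t)
  protocol : ∀ t i, (r.step t).act i ≠ .null →
    (r.step t).act i ∈ I.protocol i ((r.state t).loc i)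

/-- Every item in a store buffer is eventually propagated. -/
def Run.DispatchFair (r : Run n Var Val Intl Op Resp) : Prop :=
  ∀ i t, (r.state t).tso.buf i ≠ [] → ∃ t', t ≤ t' ∧ (r.step t').prop i = true

/-- Process `i` has an enabled (non-null) action to perform at time `t`, according to its protocol. -/
def Run.CanMove (r : Run n Var Val Intl Op Resp) (I : Implementation n Var Val Intl Op Resp)
    (i : Fin n) (t : ℕ) : Prop :=
  ∃ a ∈ I.protocol i ((r.state t).loc i), a ≠ .null ∧ (r.state t).tso.Enabled i a

/-- Process `i` does not stop moving while it continuously has an enabled action to perform. -/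
def Run.ProcFair (r : Run n Var Val Intl Op Resp) (I : Implementation n Var Val Intl Op Resp)
    (i : Fin n) : Prop :=
  ∀ t, ∃ t', t ≤ t' ∧ ((r.step t').act i ≠ .null ∨ ¬ r.CanMove I i t')

/-- Fairness to all agents. -/
def Run.Fair (r : Run n Var Val Intl Op Resp) (I : Implementation n Var Val Intl Op Resp) : Prop :=
  r.DispatchFair ∧ ∀ i, r.ProcFair I i

/-- Operation `o`, invoked at process `i` in round `t + 1`, completes with response `y` in
round `t'`. -/
def Run.OpBetween (r : Run n Var Val Intl Op Resp) (i : Fin n) (o : Op) (y : Resp) (t t' : ℕ) :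
    Prop :=
  (r.step t).inv i = some o ∧
    ∃ u, t < u ∧ t' = u + 1 ∧ (r.step u).act i = .ret y ∧
      ∀ s, t < s → s < u → ∀ z, (r.step s).act i ≠ .ret z

/-- Only `i` and its local dispatcher take actions between times `t` and `t'`. -/
def Run.Solo (r : Run n Var Val Intl Op Resp) (i : Fin n) (t t' : ℕ) : Prop :=
  ∀ s, t ≤ s → s < t' → ∀ k, k ≠ i → (r.step s).act k = .null ∧ (r.step s).prop k = false

/-- The operation of process `i` that is invoked in round `t + 1` and ends in round `t'` contains a
fence or a read-modify-write action. -/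
def Run.ContainsSync (r : Run n Var Val Intl Op Resp) (i : Fin n) (t t' : ℕ) : Prop :=
  ∃ s, t < s ∧ s < t' ∧
    ((r.step s).act i = .fence ∨ ∃ x vexp vnew, (r.step s).act i = .rmw x vexp vnew)

end Runs

/-- The operations of a snapshot object over the set `W` of values. -/
inductive SnapOp (W : Type*) where
  | update (w : W)
  | scan

/-- The responses of a snapshot object; `none` is the initial value `⊥` of each component. -/
inductive SnapResp (n : ℕ) (W : Type*) where
  | ack
  | view (V : Fin n → Option W)

/-- An operation in a linearization: its process, its start time in the run, and its response. -/
structure LinOp (n : ℕ) (W : Type*) where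
  proc : Fin n
  start : ℕ
  op : SnapOp W
  resp : SnapResp n W

/-- The sequential specification of the snapshot object, started with contents `V`. -/
def SnapLegal {n : ℕ} {W : Type*} : (Fin n → Option W) → List (LinOp n W) → Prop
  | _, [] => True
  | V, e :: L =>
    match e.op with
    | .update w => e.resp = .ack ∧ SnapLegal (Function.update V e.proc (some w)) L
    | .scan => e.resp = .view V ∧ SnapLegal V L

section Snapshot

variable {n : ℕ} {W Var Val Intl : Type*}

/-- Each process is asked to write each value at most once. -/
def Run.WriteOnce (r : Run n Var Val Intl (SnapOp W) (SnapResp n W)) : Prop :=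
  ∀ i w t t', (r.step t).inv i = some (.update w) → (r.step t').inv i = some (.update w) → t = t'

/-- `L` is a linearization of the history of the first `T` rounds of `r`: it consists of operations
invoked there, includes all those completed there (with their actual responses) and possibly some
pending ones, is legal, and respects the order of operations of each process as well as the real-time
order (an operation that ends at a time smaller than the start of another one comes first). -/
structure IsLinearization (r : Run n Var Val Intl (SnapOp W) (SnapResp n W)) (T : ℕ)
    (L : List (LinOp n W)) : Prop where
  invoked : ∀ e ∈ L, e.start < T ∧ (r.step e.start).inv e.proc = some e.op
  response : ∀ e ∈ L, ∀ y t', r.OpBetween e.proc e.op y e.start t' → t' ≤ T → e.resp = y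
  completed : ∀ i o y t t', r.OpBetween i o y t t' → t' ≤ T →
    ∃ e ∈ L, e.proc = i ∧ e.start = t
  procOrder : L.Pairwise (fun e f => e.proc = f.proc → e.start < f.start)
  realTime : L.Pairwise (fun e f =>
    ¬ ∃ y t', r.OpBetween f.proc f.op y f.start t' ∧ t' ≤ T ∧ t' < e.start)
  legal : SnapLegal (fun _ => none) L

/-- `I` is a linearizable snapshot implementation: every finite history of it has a linearization. -/
def Linearizable (I : Implementation n Var Val Intl (SnapOp W) (SnapResp n W)) : Prop :=
  ∀ r : Run n Var Val Intl (SnapOp W) (SnapResp n W), r.IsRunOf I → r.WriteOnce → r.Fair I →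
    ∀ T, ∃ L, IsLinearization r T L

/-- `I` is obstruction-free: a process with a pending operation completes it if, from some time on,
the other processes take no steps, while the process itself is scheduled fairly and buffered items
are eventually propagated. -/
def ObstructionFree (I : Implementation n Var Val Intl (SnapOp W) (SnapResp n W)) : Prop :=
  ∀ r : Run n Var Val Intl (SnapOp W) (SnapResp n W), r.IsRunOf I → r.WriteOnce → r.DispatchFair →
    ∀ i, r.ProcFair I i → ∀ t, ((r.state t).loc i).Pending →
      (∀ s, t ≤ s → ∀ k, k ≠ i → (r.step s).act k = .null) →
      ∃ s y, t ≤ s ∧ (r.step s).act i = .ret y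

end Snapshot

end TSO

/-!
Bring the system, after time `t_e`, into a state in which no operation is pending and all store
buffers are empty: obstruction-freedom lets each pending operation finish by running solo. From
there run `update_j(v)` solo. If it contained neither a fence nor a read-modify-write, then the
dispatcher of `j` could withhold all its writes: `j`, reading its own buffer, would not notice the
difference, and the memory would not change. A process `k ≠ j` that afterwards scans solo would then
behave as if the update had never been invoked, so its view would not contain `v`, whereas
linearizability requires `v`, because the update has completed. Fair schedules exist after any
finite execution, so all the executions involved extend to fair runs.
-/

namespace TSO

variable {n : ℕ} {Var Val Intl Op Resp : Type*}

/-- A sequential step of the system: a joint action in which at most one agent acts, or the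
environment invokes one operation. Executions built by hand use only such steps. -/
inductive Move (n : ℕ) (Var Val Intl Op Resp : Type*) where
  | idle
  | act (k : Fin n) (a : Act Var Val Intl Resp)
  | prop (k : Fin n)
  | inv (k : Fin n) (o : Op)

namespace Move

/-- The joint action that performs a move, all other agents being passive. -/
def toJoint : Move n Var Val Intl Op Resp → JointAction n Var Val Intl Op Resp
  | idle => ⟨fun _ => .null, fun _ => false, fun _ => none⟩
  | act k a => ⟨fun i => if i = k then a else .null, fun _ => false, fun _ => none⟩
  | prop k => ⟨fun _ => .null, fun i => decide (i = k), fun _ => none⟩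
  | inv k o => ⟨fun _ => .null, fun _ => false, fun i => if i = k then some o else none⟩

/-- The effect of a move on the global state. -/
noncomputable def apply (g : GlobalState n Var Val Intl Op Resp) :
    Move n Var Val Intl Op Resp → GlobalState n Var Val Intl Op Resp
  | idle => g
  | act k a => ⟨g.tso.doAct k a, Function.update g.loc k (g.loc k ++ g.tso.record k a)⟩
  | prop k => ⟨g.tso.doProp k, g.loc⟩
  | inv k o => ⟨g.tso, Function.update g.loc k (g.loc k ++ [.invoke o])⟩

/-- The move may occur in the state `g` of a run of `I`: it is enabled and follows the protocol. -/
def Valid (I : Implementation n Var Val Intl Op Resp) (g : GlobalState n Var Val Intl Op Resp) :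
    Move n Var Val Intl Op Resp → Prop
  | idle => True
  | act k a => a ∈ I.protocol k (g.loc k) ∧ g.tso.Enabled k a
  | prop k => g.tso.buf k ≠ []
  | inv k _ => ¬ (g.loc k).Pending

/-- The move involves no process outside `S`. Every dispatcher counts as inside `S`, because
obstruction-freedom lets the items buffered by other processes be propagated. -/
def IsBy (S : Set (Fin n)) : Move n Var Val Intl Op Resp → Prop
  | act k _ => k ∈ S
  | inv k _ => k ∈ S
  | _ => True

/-- The move involves no process outside `S` and is not an invocation. -/
def Quiet (S : Set (Fin n)) (x : Move n Var Val Intl Op Resp) : Prop :=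
  x.IsBy S ∧ ∀ k o, x ≠ inv k o

theorem eq_inv_of_toJoint {x : Move n Var Val Intl Op Resp} {k : Fin n} {o : Op}
    (h : x.toJoint.inv k = some o) : x = inv k o := by
  cases x <;> simp_all [toJoint]

theorem eq_act_of_toJoint {x : Move n Var Val Intl Op Resp} {k : Fin n}
    {a : Act Var Val Intl Resp} (h : x.toJoint.act k = a) (ha : a ≠ .null) : x = act k a := by
  cases x <;> grind [toJoint]

end Move

theorem foldl_finRange_eq_apply {σ : Type*} {f : σ → Fin n → σ} (k : Fin n)
    (hf : ∀ s i, i ≠ k → f s i = s) (s : σ) : (List.finRange n).foldl f s = f s k := by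
  have foldl_eq : ∀ l : List (Fin n), l.Nodup → ∀ s,
      l.foldl f s = if k ∈ l then f s k else s := by
    intro l hl
    induction hl with
    | nil => simp
    | @cons a l hal _ ih =>
      intro s
      by_cases ha : a = k
      · have hk : k ∉ l := fun hk => hal k hk ha
        simp [ih, hk, ha]
      · simp [ih, hf s a ha, Ne.symm ha]
  simpa using foldl_eq _ (List.nodup_finRange n) s

namespace Move

theorem doJoint_toJoint (g : GlobalState n Var Val Intl Op Resp)
    (x : Move n Var Val Intl Op Resp) : g.tso.doJoint x.toJoint = (x.apply g).tso := by
  cases x with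
  | idle => simp [MemState.doJoint, toJoint, apply, MemState.doAct]
  | act k a =>
    have acts := foldl_finRange_eq_apply (f := fun s i =>
      MemState.doAct s i (if i = k then a else .null)) k
      (fun s i hi => by simp [hi, MemState.doAct]) g.tso
    simp [MemState.doJoint, toJoint, apply, acts]
  | prop k =>
    have props := foldl_finRange_eq_apply (f := fun s i =>
      if decide (i = k) then MemState.doProp s i else s) k (fun s i hi => by simp [hi]) g.tso
    simp_all [MemState.doJoint, toJoint, apply, MemState.doAct]
  | inv k o => simp [MemState.doJoint, toJoint, apply, MemState.doAct]

theorem next_toJoint (g : GlobalState n Var Val Intl Op Resp)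
    (x : Move n Var Val Intl Op Resp) : g.next x.toJoint = x.apply g := by
  rw [GlobalState.next, doJoint_toJoint]
  congr 1
  funext i
  cases x with
  | idle => simp [toJoint, MemState.record]
  | prop k => simp [toJoint, MemState.record]
  | act k a => by_cases h : i = k <;> simp_all [toJoint, MemState.record]
  | inv k o => by_cases h : i = k <;> simp_all [toJoint, MemState.record]

theorem accessor_unique {s : MemState n Var Val} {x : Move n Var Val Intl Op Resp}
    {b c : Agent n} {v w : Var} (hb : Accesses s x.toJoint b v) (hc : Accesses s x.toJoint c w) :
    b = c := by
  cases x <;> cases b <;> cases c <;> simp only [Accesses, ReadsMem, toJoint] at hb hc <;> grind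

variable {I : Implementation n Var Val Intl Op Resp} {g : GlobalState n Var Val Intl Op Resp}
  {x : Move n Var Val Intl Op Resp}

theorem Valid.enabled (h : x.Valid I g) : x.toJoint.Enabled g where
  act i := by cases x <;> grind [toJoint, MemState.Enabled, Valid]
  prop i hi := by cases x <;> simp_all [toJoint, Valid]
  noConflict _ _ hbc := fun ⟨_, hb, hc, _⟩ => hbc (accessor_unique hb hc)
  inv i o hi := by
    obtain rfl := eq_inv_of_toJoint hi
    simpa [toJoint, MemState.record, Valid] using h

theorem Valid.mem_protocol (h : x.Valid I g) {i : Fin n} (hi : x.toJoint.act i ≠ .null) :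
    x.toJoint.act i ∈ I.protocol i (g.loc i) := by
  have hx := eq_act_of_toJoint rfl hi
  rw [hx] at h
  exact h.1

end Move

/-- A finite execution of `I` from `g` to `g'` that consists of the given moves. -/
inductive Exec (I : Implementation n Var Val Intl Op Resp) :
    GlobalState n Var Val Intl Op Resp → List (Move n Var Val Intl Op Resp) →
    GlobalState n Var Val Intl Op Resp → Prop
  | nil (g) : Exec I g [] g
  | cons {g x ms g'} : x.Valid I g → Exec I (x.apply g) ms g' → Exec I g (x :: ms) g'

namespace Exec

variable {I : Implementation n Var Val Intl Op Resp}
  {g g' g'' : GlobalState n Var Val Intl Op Resp} {ms ms' : List (Move n Var Val Intl Op Resp)}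

theorem append (h : Exec I g ms g') (h' : Exec I g' ms' g'') : Exec I g (ms ++ ms') g'' := by
  induction h with
  | nil => exact h'
  | cons hx _ ih => exact .cons hx (ih h')

theorem exists_of_append (h : Exec I g (ms ++ ms') g'') :
    ∃ g', Exec I g ms g' ∧ Exec I g' ms' g'' := by
  induction ms generalizing g with
  | nil => exact ⟨g, .nil _, h⟩
  | cons x ms ih =>
    obtain _ | ⟨hx, h⟩ := h
    obtain ⟨g', h₁, h₂⟩ := ih h
    exact ⟨g', .cons hx h₁, h₂⟩

theorem single {x : Move n Var Val Intl Op Resp} (h : x.Valid I g) : Exec I g [x] (x.apply g) :=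
  .cons h (.nil _)

end Exec

theorem Run.IsRunOf.exec_range_map {I : Implementation n Var Val Intl Op Resp}
    {r : Run n Var Val Intl Op Resp} (hr : r.IsRunOf I) {T : ℕ}
    {mv : ℕ → Move n Var Val Intl Op Resp}
    (hmv : ∀ t ≥ T, r.step t = (mv t).toJoint ∧ (mv t).Valid I (r.state t)) (N : ℕ) :
    Exec I (r.state T) ((List.range N).map fun m => mv (T + m)) (r.state (T + N)) := by
  induction N with
  | zero => exact .nil _
  | succ N ih =>
    obtain ⟨hstep, hvalid⟩ := hmv (T + N) (Nat.le_add_right _ _)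
    rw [List.range_succ, List.map_append, ← Nat.add_assoc, hr.next, hstep, Move.next_toJoint]
    exact ih.append (.single hvalid)

namespace Run

/-- The runs `r` and `r'` coincide up to time `T`. -/
structure AgreesUpTo (r r' : Run n Var Val Intl Op Resp) (T : ℕ) : Prop where
  state : ∀ t ≤ T, r'.state t = r.state t
  step : ∀ t < T, r'.step t = r.step t

theorem AgreesUpTo.trans {r r' r'' : Run n Var Val Intl Op Resp} {T T' : ℕ}
    (h : r.AgreesUpTo r' T) (h' : r'.AgreesUpTo r'' T') (hT : T ≤ T') : r.AgreesUpTo r'' T where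
  state t ht := (h'.state t (ht.trans hT)).trans (h.state t ht)
  step t ht := (h'.step t (ht.trans_le hT)).trans (h.step t ht)

theorem AgreesUpTo.opBetween {r r' : Run n Var Val Intl Op Resp} {T : ℕ} (h : r.AgreesUpTo r' T)
    {i : Fin n} {o : Op} {y : Resp} {ts te : ℕ} (ho : r.OpBetween i o y ts te) (hT : te ≤ T) :
    r'.OpBetween i o y ts te := by
  obtain ⟨hinv, u, htu, rfl, hret, hmid⟩ := ho
  refine ⟨?_, u, htu, rfl, ?_, fun s hts hsu => ?_⟩
  · rwa [h.step ts (by lia)]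
  · rwa [h.step u (by lia)]
  · rw [h.step s (by lia)]
    exact hmid s hts hsu

/-- The states of the run that follows `r` until time `T` and then makes the moves `σ t g`
prescribed by the time and the current state. -/
noncomputable def extendState (r : Run n Var Val Intl Op Resp) (T : ℕ)
    (σ : ℕ → GlobalState n Var Val Intl Op Resp → Move n Var Val Intl Op Resp) :
    ℕ → GlobalState n Var Val Intl Op Resp
  | 0 => r.state 0
  | t + 1 =>
    if t < T then r.state (t + 1)
    else (σ t (extendState r T σ t)).apply (extendState r T σ t)

theorem extendState_of_le (r : Run n Var Val Intl Op Resp) {T t : ℕ} (ht : t ≤ T)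
    (σ : ℕ → GlobalState n Var Val Intl Op Resp → Move n Var Val Intl Op Resp) :
    r.extendState T σ t = r.state t := by
  cases t with
  | zero => rfl
  | succ t => exact if_pos ht

namespace IsRunOf

variable {I : Implementation n Var Val Intl Op Resp} {r : Run n Var Val Intl Op Resp}

theorem exists_extension (hr : r.IsRunOf I) (T : ℕ)
    (σ : ℕ → GlobalState n Var Val Intl Op Resp → Move n Var Val Intl Op Resp)
    (hT : (σ T (r.state T)).Valid I (r.state T)) (hσ : ∀ t > T, ∀ g, (σ t g).Valid I g) :
    ∃ r' : Run n Var Val Intl Op Resp, r'.IsRunOf I ∧ r.AgreesUpTo r' T ∧ ∀ t ≥ T,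
      r'.step t = (σ t (r'.state t)).toJoint ∧ (σ t (r'.state t)).Valid I (r'.state t) := by
  let r' : Run n Var Val Intl Op Resp :=
    { state := r.extendState T σ
      step := fun t => if t < T then r.step t else (σ t (r.extendState T σ t)).toJoint }
  have state_le : ∀ t ≤ T, r'.state t = r.state t := fun t ht => r.extendState_of_le ht σ
  have step_lt : ∀ t < T, r'.step t = r.step t := fun t ht => if_pos ht
  have step_ge : ∀ t ≥ T, r'.step t = (σ t (r'.state t)).toJoint := fun t ht => if_neg ht.not_gt
  have valid : ∀ t ≥ T, (σ t (r'.state t)).Valid I (r'.state t) := by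
    intro t ht
    obtain rfl | ht := ht.eq_or_lt
    · rwa [state_le _ le_rfl]
    · exact hσ t ht _
  refine ⟨r', ⟨?_, ?_, ?_, fun t => ?_, fun t => ?_, fun t i hi => ?_⟩, ⟨state_le, step_lt⟩,
    fun t ht => ⟨step_ge t ht, valid t ht⟩⟩
  · exact hr.init_mem
  · exact hr.init_buf
  · exact hr.init_loc
  · obtain ht | ht := lt_or_ge t T
    · rw [step_lt t ht, state_le t ht.le]
      exact hr.enabled t
    · rw [step_ge t ht]
      exact (valid t ht).enabled
  · obtain ht | ht := lt_or_ge t T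
    · rw [step_lt t ht, state_le t ht.le, state_le (t + 1) ht]
      exact hr.next t
    · rw [step_ge t ht, Move.next_toJoint]
      exact if_neg ht.not_gt
  · obtain ht | ht := lt_or_ge t T
    · rw [step_lt t ht] at hi ⊢
      rw [state_le t ht.le]
      exact hr.protocol t i hi
    · rw [step_ge t ht] at hi ⊢
      exact (valid t ht).mem_protocol hi

theorem exists_move (hr : r.IsRunOf I) {T : ℕ} {x : Move n Var Val Intl Op Resp}
    (hx : x.Valid I (r.state T)) :
    ∃ r' : Run n Var Val Intl Op Resp, r'.IsRunOf I ∧ r.AgreesUpTo r' T ∧ r'.step T = x.toJoint ∧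
      r'.state (T + 1) = x.apply (r.state T) := by
  obtain ⟨r', hr', hagree, hσ⟩ := hr.exists_extension T (fun t _ => if t = T then x else .idle)
    (by rwa [if_pos rfl]) (fun t ht g => by rw [if_neg ht.ne']; trivial)
  have hstep : r'.step T = x.toJoint := by rw [(hσ T le_rfl).1, if_pos rfl]
  refine ⟨r', hr', hagree, hstep, ?_⟩
  rw [hr'.next, hstep, Move.next_toJoint, hagree.state T le_rfl]

end IsRunOf

end Run

section FairExtension

variable {I : Implementation n Var Val Intl Op Resp} {r : Run n Var Val Intl Op Resp}

theorem exists_fair_schedule (α : Type*) [Countable α] :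
    ∃ f : ℕ → Option α, ∀ a t, ∃ m ≥ t, f m = some a := by
  have := Encodable.ofCountable α
  exact ⟨fun m => Encodable.decode m.unpair.1, fun a t =>
    ⟨Nat.pair (Encodable.encode a) t, Nat.right_le_pair _ _, by simp⟩⟩

instance : Countable (Agent n) :=
  Function.Injective.countable (β := Fin n ⊕ Fin n)
    (f := fun | .proc i => .inl i | .disp i => .inr i)
    (fun a b h => by cases a <;> cases b <;> simp_all)

open Classical in
/-- The move made in the state `g` by the agent to which a scheduler gives the turn: any enabled
action that the protocol allows, or a propagation. Processes outside `S` waste their turns. -/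
noncomputable def agentMove (I : Implementation n Var Val Intl Op Resp) (S : Set (Fin n))
    (g : GlobalState n Var Val Intl Op Resp) : Agent n → Move n Var Val Intl Op Resp
  | .disp k => if g.tso.buf k ≠ [] then .prop k else .idle
  | .proc k =>
    if h : k ∈ S ∧ ∃ a ∈ I.protocol k (g.loc k), a ≠ .null ∧ g.tso.Enabled k a then
      .act k h.2.choose
    else .idle

theorem agentMove_valid (S : Set (Fin n)) (g : GlobalState n Var Val Intl Op Resp) (a : Agent n) :
    (agentMove I S g a).Valid I g := by
  cases a with
  | disp k =>
    rw [agentMove]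
    split_ifs with h
    · exact h
    · trivial
  | proc k =>
    rw [agentMove]
    split_ifs with h
    · exact ⟨h.2.choose_spec.1, h.2.choose_spec.2.2⟩
    · trivial

theorem agentMove_quiet (S : Set (Fin n)) (g : GlobalState n Var Val Intl Op Resp) (a : Agent n) :
    (agentMove I S g a).Quiet S := by
  cases a <;> rw [agentMove] <;> split_ifs with h
  exacts [⟨h.1, nofun⟩, ⟨trivial, nofun⟩, ⟨trivial, nofun⟩, ⟨trivial, nofun⟩]

theorem agentMove_act_ne_null {S : Set (Fin n)} {g : GlobalState n Var Val Intl Op Resp}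
    {k : Fin n} (hk : k ∈ S) (h : ∃ a ∈ I.protocol k (g.loc k), a ≠ .null ∧ g.tso.Enabled k a) :
    (agentMove I S g (.proc k)).toJoint.act k ≠ .null := by
  have hkS : k ∈ S ∧ ∃ a ∈ I.protocol k (g.loc k), a ≠ .null ∧ g.tso.Enabled k a := ⟨hk, h⟩
  rw [agentMove, dif_pos hkS]
  simpa only [Move.toJoint, if_true] using hkS.2.choose_spec.2.1

namespace MemState

variable {s : MemState n Var Val} {i : Fin n}

theorem doAct_buf_ne_nil (h : s.buf i ≠ []) (k : Fin n) (a : Act Var Val Intl Resp) :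
    (s.doAct k a).buf i ≠ [] := by
  cases a with
  | write x v =>
    by_cases hik : i = k
    · simp [doAct, hik]
    · simpa [doAct, Function.update_of_ne hik] using h
  | _ => exact h

theorem doProp_buf_of_ne (s : MemState n Var Val) {k : Fin n} (hik : i ≠ k) :
    (s.doProp k).buf i = s.buf i := by
  rw [doProp]
  split
  · rfl
  · exact Function.update_of_ne hik _ _

theorem doJoint_buf_ne_nil (h : s.buf i ≠ []) {a : JointAction n Var Val Intl Op Resp}
    (ha : a.prop i ≠ true) : (s.doJoint a).buf i ≠ [] := by
  have acts : ((List.finRange n).foldl (fun s i => s.doAct i (a.act i)) s).buf i ≠ [] :=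
    List.foldlRecOn (motive := fun s : MemState n Var Val => s.buf i ≠ []) _ _ h
      fun s hs k _ => doAct_buf_ne_nil hs k _
  refine List.foldlRecOn (motive := fun s : MemState n Var Val => s.buf i ≠ []) _ _ acts
    fun s hs k _ => ?_
  split_ifs with hk
  · rwa [doProp_buf_of_ne]
    rintro rfl
    exact ha hk
  · exact hs

end MemState

namespace Run

theorem IsRunOf.dispatchFair (hr : r.IsRunOf I)
    (h : ∀ i t, ∃ t' ≥ t, (r.state t').tso.buf i ≠ [] → (r.step t').prop i = true) :
    r.DispatchFair := by
  intro i t hbuf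
  by_contra! hno
  have hbuf' : ∀ t' ≥ t, (r.state t').tso.buf i ≠ [] := fun t' ht' => by
    induction t', ht' using Nat.le_induction with
    | base => exact hbuf
    | succ t' ht' ih =>
      rw [hr.next]
      exact MemState.doJoint_buf_ne_nil ih (hno t' ht')
  obtain ⟨t', ht', hprop⟩ := h i t
  exact hno t' ht' (hprop (hbuf' t' ht'))

/-- The run `r'` follows `r` until time `T`, makes the moves `ms`, which lead to `g`, and goes on
without invocations, with a schedule that is fair to all dispatchers and to the processes in `S`
and in which the other processes do not act. -/
structure Continues (I : Implementation n Var Val Intl Op Resp)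
    (r : Run n Var Val Intl Op Resp) (T : ℕ) (ms : List (Move n Var Val Intl Op Resp))
    (g : GlobalState n Var Val Intl Op Resp) (S : Set (Fin n))
    (r' : Run n Var Val Intl Op Resp) : Prop where
  isRunOf : r'.IsRunOf I
  agree : r.AgreesUpTo r' T
  moves : ∀ m (hm : m < ms.length), r'.step (T + m) = ms[m].toJoint
  state_add_length : r'.state (T + ms.length) = g
  dispatchFair : r'.DispatchFair
  procFair : ∀ i ∈ S, r'.ProcFair I i
  tail : ∀ t ≥ T + ms.length, ∃ x : Move n Var Val Intl Op Resp,
    r'.step t = x.toJoint ∧ x.Valid I (r'.state t) ∧ x.Quiet S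

theorem IsRunOf.exists_continues_nil (hr : r.IsRunOf I) (T : ℕ) (S : Set (Fin n)) :
    ∃ r', Continues I r T [] (r.state T) S r' := by
  obtain ⟨f, hf⟩ := exists_fair_schedule (Agent n)
  let σ : ℕ → GlobalState n Var Val Intl Op Resp → Move n Var Val Intl Op Resp :=
    fun t g => (f t).elim .idle (agentMove I S g)
  have valid : ∀ t g, (σ t g).Valid I g := fun t g => by
    cases h : f t <;> simp only [σ, h, Option.elim]
    exacts [trivial, agentMove_valid _ _ _]
  have quiet : ∀ t g, (σ t g).Quiet S := fun t g => by
    cases h : f t <;> simp only [σ, h, Option.elim]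
    exacts [⟨trivial, nofun⟩, agentMove_quiet _ _ _]
  obtain ⟨r', hr', hagree, hσ⟩ := hr.exists_extension T σ (valid _ _) fun t _ => valid t
  have turn : ∀ a t, ∃ t' ≥ t, r'.step t' = (agentMove I S (r'.state t') a).toJoint :=
    fun a t => by
      obtain ⟨t', ht', ha⟩ := hf a (max t T)
      exact ⟨t', le_of_max_le_left ht', by simp [(hσ t' (le_of_max_le_right ht')).1, σ, ha]⟩
  refine ⟨r', hr', hagree, nofun, hagree.state T le_rfl, hr'.dispatchFair fun i t => ?_,
    fun i hi t => ?_, fun t ht => ⟨_, (hσ t ht).1, valid _ _, quiet _ _⟩⟩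
  · obtain ⟨t', ht', hstep⟩ := turn (.disp i) t
    exact ⟨t', ht', fun hbuf => by simp [hstep, agentMove, hbuf, Move.toJoint]⟩
  · obtain ⟨t', ht', hstep⟩ := turn (.proc i) t
    refine ⟨t', ht', or_iff_not_imp_right.2 fun hmove => ?_⟩
    rw [hstep]
    exact agentMove_act_ne_null hi (not_not.1 hmove)

theorem IsRunOf.exists_continues (hr : r.IsRunOf I) {T : ℕ}
    {ms : List (Move n Var Val Intl Op Resp)} {g : GlobalState n Var Val Intl Op Resp}
    (h : Exec I (r.state T) ms g) (S : Set (Fin n)) : ∃ r', Continues I r T ms g S r' := by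
  induction ms generalizing r T with
  | nil =>
    cases h
    exact hr.exists_continues_nil T S
  | cons x ms ih =>
    obtain _ | ⟨hx, h⟩ := h
    obtain ⟨r₁, hr₁, hagree, hstep, hstate⟩ := hr.exists_move hx
    rw [← hstate] at h
    obtain ⟨r', c⟩ := ih hr₁ h
    refine ⟨r', c.isRunOf, hagree.trans c.agree (Nat.le_succ T), fun m hm => ?_, ?_,
      c.dispatchFair, c.procFair, fun t ht => c.tail t (by grind)⟩
    · cases m with
      | zero => exact (c.agree.step T (Nat.lt_succ_self T)).trans hstep
      | succ m => grind [c.moves m (by simpa using hm)]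
    · grind [c.state_add_length]

end Run

end FairExtension

section Buffers

open Classical in
theorem bufLookup_append_singleton (β : List (Var × Val)) (x y : Var) (v : Val) :
    bufLookup (β ++ [(x, v)]) y = if x = y then some v else bufLookup β y := by
  by_cases h : x = y <;> simp [bufLookup, List.filter_append, h]

open Classical in
theorem bufLookup_cons (β : List (Var × Val)) (x y : Var) (v : Val) :
    bufLookup ((x, v) :: β) y = (bufLookup β y).or (if x = y then some v else none) := by
  by_cases h : x = y
  · simp only [bufLookup, List.filter_cons, h, decide_true, if_true, List.getLast?_cons]
    cases (β.filter fun p => p.1 = y).getLast? <;> rfl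
  · simp [bufLookup, h]

/-- The synchronization actions: fences and read-modify-writes. -/
def Act.IsSync : Act Var Val Intl Resp → Prop
  | .fence => True
  | .rmw _ _ _ => True
  | _ => False

theorem Act.IsSync.eq_fence_or_rmw {a : Act Var Val Intl Resp} (ha : a.IsSync) :
    a = .fence ∨ ∃ x vexp vnew, a = .rmw x vexp vnew := by
  cases a with
  | fence => exact .inl rfl
  | rmw x vexp vnew => exact .inr ⟨x, vexp, vnew, rfl⟩
  | _ => exact ha.elim

namespace MemState

variable {s s' : MemState n Var Val} {k p : Fin n} {a : Act Var Val Intl Resp}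

theorem doProp_buf (s : MemState n Var Val) (k : Fin n) :
    (s.doProp k).buf = Function.update s.buf k (s.buf k).tail := by
  rw [doProp]
  split <;> simp_all

theorem readVal_doProp (s : MemState n Var Val) (k : Fin n) (y : Var) :
    (s.doProp k).readVal k y = s.readVal k y := by
  rw [doProp]
  split
  · rfl
  · next x v β hbuf =>
    simp only [readVal, hbuf, bufLookup_cons, Function.update_self]
    cases bufLookup β y <;> grind [Function.update_apply]

open Classical in
theorem readVal_doAct_write (s : MemState n Var Val) (k : Fin n) (x y : Var) (v : Val) :
    (s.doAct k (.write x v : Act Var Val Intl Resp)).readVal k y =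
      if x = y then v else s.readVal k y := by
  simp only [doAct, readVal, Function.update_self, bufLookup_append_singleton]
  split_ifs <;> simp

theorem doAct_buf_of_ne (s : MemState n Var Val) (hpk : p ≠ k) (a : Act Var Val Intl Resp) :
    (s.doAct k a).buf p = s.buf p := by
  cases a <;> simp [doAct, hpk]

theorem doAct_mem (ha : ¬ a.IsSync) (s : MemState n Var Val) (k : Fin n) :
    (s.doAct k a).mem = s.mem := by
  cases a <;> simp_all [doAct, Act.IsSync]

theorem enabled_of_not_isSync (ha : ¬ a.IsSync) (s : MemState n Var Val) (k : Fin n) :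
    s.Enabled k a := by
  cases a <;> simp_all [Enabled, Act.IsSync]

theorem record_congr (h : ∀ y, s'.readVal k y = s.readVal k y) (a : Act Var Val Intl Resp) :
    (s'.record k a : List (Rec Var Val Intl Op Resp)) = s.record k a := by
  cases a <;> simp [record, h]

theorem readVal_doAct_congr (h : ∀ y, s'.readVal k y = s.readVal k y) (ha : ¬ a.IsSync) (y : Var) :
    (s'.doAct k a).readVal k y = (s.doAct k a).readVal k y := by
  cases a with
  | write x v => simp only [readVal_doAct_write, h]
  | rmw x vexp vnew => exact (ha trivial).elim
  | _ => exact h y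

end MemState

end Buffers

section Replay

variable {I : Implementation n Var Val Intl Op Resp}
  {g g' h : GlobalState n Var Val Intl Op Resp} {ms : List (Move n Var Val Intl Op Resp)}
  {x : Move n Var Val Intl Op Resp} {j k p : Fin n} {m : Var → Val}

/-- Process `j` cannot tell `h` from `g`, but in `h` the memory is still `m`: what `j` has written
since waits in its buffer, which alone may be nonempty. -/
structure Delayed (j : Fin n) (m : Var → Val) (g h : GlobalState n Var Val Intl Op Resp) :
    Prop where
  loc : h.loc = g.loc
  readVal : ∀ y, h.tso.readVal j y = g.tso.readVal j y
  mem : h.tso.mem = m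
  buf : ∀ p ≠ j, g.tso.buf p = [] ∧ h.tso.buf p = []

/-- Process `k` and its dispatcher cannot tell `h` from `g` as long as the other agents do not
move; in `g`, the dispatchers of the other processes have nothing to propagate. -/
structure Mirrors (k : Fin n) (g h : GlobalState n Var Val Intl Op Resp) : Prop where
  loc : h.loc k = g.loc k
  buf : h.tso.buf k = g.tso.buf k
  mem : h.tso.mem = g.tso.mem
  buf_of_ne : ∀ p ≠ k, g.tso.buf p = []

namespace Move

/-- The move is a propagation. -/
def isProp : Move n Var Val Intl Op Resp → Bool
  | prop _ => true
  | _ => false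

theorem apply_loc_of_ne (hpk : p ≠ k) (hx : x.IsBy {k}) : (x.apply g).loc p = g.loc p := by
  cases x with
  | act q a =>
    obtain rfl : q = k := hx
    exact Function.update_of_ne hpk _ _
  | inv q o =>
    obtain rfl : q = k := hx
    exact Function.update_of_ne hpk _ _
  | _ => rfl

end Move

theorem Exec.loc_of_ne (hpk : p ≠ k) (he : Exec I g ms g') (hms : ∀ x ∈ ms, x.IsBy {k}) :
    g'.loc p = g.loc p := by
  induction he with
  | nil => rfl
  | cons _ _ ih =>
    rw [List.forall_mem_cons] at hms
    rw [ih hms.2, Move.apply_loc_of_ne hpk hms.1]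

theorem Delayed.apply_prop (d : Delayed j m g h) (hv : (Move.prop k).Valid I g) :
    Delayed j m ((Move.prop k).apply g) h := by
  obtain rfl : k = j := by_contra fun hkj => hv (d.buf k hkj).1
  exact ⟨d.loc, fun y => (d.readVal y).trans (MemState.readVal_doProp _ _ _).symm, d.mem,
    fun p hp => ⟨(MemState.doProp_buf_of_ne _ hp).trans (d.buf p hp).1, (d.buf p hp).2⟩⟩

theorem Delayed.apply (d : Delayed j m g h) (hv : x.Valid I g) (hx : x.IsBy {j})
    (hprop : x.isProp = false) (hsync : ∀ k a, x = .act k a → ¬ a.IsSync) :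
    x.Valid I h ∧ Delayed j m (x.apply g) (x.apply h) := by
  cases x with
  | idle => exact ⟨trivial, d⟩
  | prop k => cases hprop
  | inv k o =>
    refine ⟨by rwa [Move.Valid, d.loc], ?_, d.readVal, d.mem, d.buf⟩
    simp only [Move.apply, d.loc]
  | act k a =>
    obtain rfl : k = j := hx
    have ha := hsync k a rfl
    refine ⟨⟨by rw [d.loc]; exact hv.1, MemState.enabled_of_not_isSync ha _ _⟩, ?_,
      MemState.readVal_doAct_congr d.readVal ha, (MemState.doAct_mem ha _ _).trans d.mem,
      fun p hp => ?_⟩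
    · simp only [Move.apply, d.loc, MemState.record_congr d.readVal]
    · simpa only [Move.apply, MemState.doAct_buf_of_ne _ hp] using d.buf p hp

theorem Exec.filter_not_isProp (he : Exec I g ms g') (hms : ∀ x ∈ ms, x.IsBy {j})
    (hsync : ∀ k a, .act k a ∈ ms → ¬ a.IsSync) (d : Delayed j m g h) :
    ∃ h', Exec I h (ms.filter (!·.isProp)) h' ∧ Delayed j m g' h' := by
  induction he generalizing h with
  | nil => exact ⟨h, .nil _, d⟩
  | @cons g x ms g' hv _ ih =>
    rw [List.forall_mem_cons] at hms
    have hsync' : ∀ k a, .act k a ∈ ms → ¬ a.IsSync :=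
      fun k a ha => hsync k a (List.mem_cons_of_mem _ ha)
    cases hprop : x.isProp with
    | true =>
      obtain ⟨k, rfl⟩ : ∃ k, x = .prop k := by cases x <;> simp_all [Move.isProp]
      simpa [hprop] using ih hms.2 hsync' (d.apply_prop hv)
    | false =>
      obtain ⟨hv', d'⟩ := d.apply hv hms.1 hprop fun k a hx => hsync k a (hx ▸ List.mem_cons_self)
      obtain ⟨h', he', d''⟩ := ih hms.2 hsync' d'
      exact ⟨h', by simpa [hprop] using he'.cons hv', d''⟩

theorem Mirrors.readVal (sim : Mirrors k g h) (y : Var) :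
    h.tso.readVal k y = g.tso.readVal k y := by
  simp only [MemState.readVal, sim.buf, sim.mem]

theorem Mirrors.apply (sim : Mirrors k g h) (hv : x.Valid I g) (hx : x.IsBy {k}) :
    x.Valid I h ∧ Mirrors k (x.apply g) (x.apply h) := by
  cases x with
  | idle => exact ⟨trivial, sim⟩
  | inv p o =>
    obtain rfl : p = k := hx
    refine ⟨by rwa [Move.Valid, sim.loc], ?_, sim.buf, sim.mem, sim.buf_of_ne⟩
    simp only [Move.apply, Function.update_self, sim.loc]
  | prop p =>
    obtain rfl : p = k := by_contra fun hpk => hv (sim.buf_of_ne p hpk)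
    refine ⟨by rwa [Move.Valid, sim.buf], sim.loc, ?_, ?_,
      fun q hq => (MemState.doProp_buf_of_ne _ hq).trans (sim.buf_of_ne q hq)⟩
    · simp only [Move.apply, MemState.doProp_buf, Function.update_self, sim.buf]
    · simp only [Move.apply, MemState.doProp, sim.buf]
      split
      · exact sim.mem
      · simp only [sim.mem]
  | act p a =>
    obtain rfl : p = k := hx
    refine ⟨⟨by rw [sim.loc]; exact hv.1, ?_⟩, ?_, ?_, ?_,
      fun q hq => (MemState.doAct_buf_of_ne _ hq a).trans (sim.buf_of_ne q hq)⟩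
    · have enabled := hv.2
      cases a <;> simp_all [MemState.Enabled, sim.buf, sim.mem]
    · simp only [Move.apply, Function.update_self, sim.loc, MemState.record_congr sim.readVal]
    · cases a <;> simp [Move.apply, MemState.doAct, sim.buf]
    · cases a <;> simp [Move.apply, MemState.doAct, sim.mem]

theorem Exec.replay (he : Exec I g ms g') (hms : ∀ x ∈ ms, x.IsBy {k}) (sim : Mirrors k g h) :
    ∃ h', Exec I h ms h' := by
  induction he generalizing h with
  | nil => exact ⟨h, .nil _⟩
  | cons hv _ ih =>
    rw [List.forall_mem_cons] at hms
    obtain ⟨hv', sim'⟩ := sim.apply hv hms.1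
    obtain ⟨h', he'⟩ := ih hms.2 sim'
    exact ⟨h', he'.cons hv'⟩

theorem Exec.exists_flush (I : Implementation n Var Val Intl Op Resp)
    (g : GlobalState n Var Val Intl Op Resp) :
    ∃ ms g', Exec I g ms g' ∧ (∀ x ∈ ms, x.Quiet ∅) ∧ g'.loc = g.loc ∧
      ∀ k, g'.tso.buf k = [] := by
  induction hN : ∑ k, (g.tso.buf k).length using Nat.strong_induction_on generalizing g with
  | _ N ih =>
    subst hN
    by_cases hbuf : ∀ k, g.tso.buf k = []
    · exact ⟨[], g, .nil _, List.forall_mem_nil _, rfl, hbuf⟩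
    obtain ⟨k, hk⟩ := not_forall.1 hbuf
    have shorter : ∑ p, ((g.tso.doProp k).buf p).length < ∑ p, (g.tso.buf p).length := by
      refine Finset.sum_lt_sum (fun p _ => ?_) ⟨k, Finset.mem_univ k, ?_⟩
      · obtain rfl | hpk := eq_or_ne p k
        · simp [MemState.doProp_buf]
        · rw [MemState.doProp_buf_of_ne _ hpk]
      · simpa [MemState.doProp_buf] using List.length_pos_iff.2 hk
    obtain ⟨ms, g', he, hquiet, hloc, hbuf'⟩ := ih _ shorter ((Move.prop k).apply g) rfl
    exact ⟨.prop k :: ms, g', he.cons hk, List.forall_mem_cons.2 ⟨⟨trivial, nofun⟩, hquiet⟩,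
      hloc, hbuf'⟩

end Replay

section SoloOperations

variable {I : Implementation n Var Val Intl Op Resp}
  {g g₁ g₂ : GlobalState n Var Val Intl Op Resp} {ms : List (Move n Var Val Intl Op Resp)}
  {j k : Fin n} {o o' : Op} {y z : Resp}

/-- The moves of a complete solo operation: `k` is asked to perform `o`, then makes the moves `ms`,
and finally responds with `y`. -/
def soloOp (k : Fin n) (o : Op) (ms : List (Move n Var Val Intl Op Resp)) (y : Resp) :
    List (Move n Var Val Intl Op Resp) :=
  .inv k o :: (ms ++ [.act k (.ret y)])

/-- The moves may occur in a solo operation of `k` between its invocation and its response. -/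
def SoloBody (k : Fin n) (ms : List (Move n Var Val Intl Op Resp)) : Prop :=
  ∀ x ∈ ms, x.Quiet {k} ∧ ∀ y, x ≠ .act k (.ret y)

theorem SoloBody.isBy_soloOp (hms : SoloBody k ms) (o : Op) (y : Resp) :
    ∀ x ∈ soloOp k o ms y, x.IsBy {k} := by
  simp only [soloOp, List.forall_mem_cons, List.forall_mem_append]
  exact ⟨rfl, fun x hx => (hms x hx).1.1, rfl, List.forall_mem_nil _⟩

theorem length_soloOp (k : Fin n) (o : Op) (ms : List (Move n Var Val Intl Op Resp)) (y : Resp) :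
    (soloOp k o ms y).length = ms.length + 2 := by
  simp [soloOp]

theorem soloOp_filter_not_isProp (k : Fin n) (o : Op) (ms : List (Move n Var Val Intl Op Resp))
    (y : Resp) :
    (soloOp k o ms y).filter (!·.isProp) = soloOp k o (ms.filter (!·.isProp)) y := by
  simp [soloOp, Move.isProp]

theorem SoloBody.exists_hidden_op {mu : List (Move n Var Val Intl Op Resp)}
    (hmu : SoloBody j mu) (hms : SoloBody k ms) (hkj : k ≠ j) (hbuf : ∀ p, g.tso.buf p = [])
    (hsync : ∀ p a, .act p a ∈ mu → ¬ a.IsSync) (he : Exec I g (soloOp j o mu z) g₁)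
    (he' : Exec I g (soloOp k o' ms y) g₂) :
    ∃ mu' g₁' g₂', SoloBody j mu' ∧ Exec I g (soloOp j o mu' z) g₁' ∧
      Exec I g₁' (soloOp k o' ms y) g₂' := by
  have hsync' : ∀ p a, .act p a ∈ soloOp j o mu z → ¬ a.IsSync := by
    intro p a ha
    simp only [soloOp, List.mem_cons, List.mem_append, reduceCtorEq, false_or, List.not_mem_nil,
      or_false, Move.act.injEq] at ha
    obtain ha | ⟨-, rfl⟩ := ha
    · exact hsync p a ha
    · exact id
  have delayed : Delayed j g.tso.mem g g := ⟨rfl, fun _ => rfl, rfl, fun p _ => ⟨hbuf p, hbuf p⟩⟩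
  obtain ⟨g₁', hdelayed, d⟩ := he.filter_not_isProp (hmu.isBy_soloOp o z) hsync' delayed
  have sim : Mirrors k g g₁' :=
    { loc := by rw [d.loc, he.loc_of_ne hkj (hmu.isBy_soloOp o z)]
      buf := by rw [(d.buf k hkj).2, hbuf]
      mem := d.mem
      buf_of_ne := fun p _ => hbuf p }
  obtain ⟨g₂', hreplay⟩ := he'.replay (hms.isBy_soloOp o' y) sim
  exact ⟨mu.filter (!·.isProp), g₁', g₂', fun x hx => hmu x (List.mem_of_mem_filter hx),
    by rwa [← soloOp_filter_not_isProp], hreplay⟩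

namespace Run.Continues

variable {r r' : Run n Var Val Intl Op Resp} {T : ℕ} {S : Set (Fin n)}

theorem step_soloOp {a b c : List (Move n Var Val Intl Op Resp)}
    (h : Continues I r T ms g S r') (hms : ms = a ++ soloOp k o b y ++ c) {m : ℕ}
    (hm : m < (soloOp k o b y).length) :
    r'.step (T + a.length + m) = (soloOp k o b y)[m].toJoint := by
  subst hms
  rw [Nat.add_assoc, h.moves (a.length + m) (by grind)]
  grind

theorem opBetween {a b c : List (Move n Var Val Intl Op Resp)}
    (h : Continues I r T ms g S r') (hms : ms = a ++ soloOp k o b y ++ c) (hb : SoloBody k b) :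
    r'.OpBetween k o y (T + a.length) (T + a.length + b.length + 2) := by
  have step (m : ℕ) (hm : m < (soloOp k o b y).length) := h.step_soloOp hms hm
  have hlen := length_soloOp k o b y
  refine ⟨?_, T + a.length + (b.length + 1), by lia, by lia, ?_, fun s hs hs' w hw => ?_⟩
  · simpa [soloOp, Move.toJoint] using congrArg (·.inv k) (step 0 (by lia))
  · simpa [soloOp, Move.toJoint] using congrArg (·.act k) (step (b.length + 1) (by lia))
  · obtain ⟨d, rfl⟩ := Nat.exists_eq_add_of_lt hs
    have hd : d < b.length := by lia
    rw [Nat.add_assoc, step (d + 1) (by lia)] at hw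
    simp only [soloOp, List.getElem_cons_succ, List.getElem_append_left hd] at hw
    exact (hb _ (List.getElem_mem hd)).2 w (Move.eq_act_of_toJoint hw nofun)

theorem containsSync {a b c : List (Move n Var Val Intl Op Resp)}
    (h : Continues I r T ms g S r') (hms : ms = a ++ soloOp k o b y ++ c) (hb : SoloBody k b)
    {p : Fin n} {α : Act Var Val Intl Resp} (hα : .act p α ∈ b) (hsync : α.IsSync) :
    r'.ContainsSync k (T + a.length) (T + a.length + b.length + 2) := by
  obtain rfl : p = k := (hb _ hα).1.1
  obtain ⟨d, hd, hbd⟩ := List.getElem_of_mem hα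
  have hact : (r'.step (T + a.length + (d + 1))).act p = α := by
    rw [h.step_soloOp hms (by rw [length_soloOp]; lia)]
    simp [soloOp, List.getElem_append_left hd, hbd, Move.toJoint]
  exact ⟨T + a.length + (d + 1), by lia, by lia, by rw [hact]; exact hsync.eq_fence_or_rmw⟩

end Run.Continues

end SoloOperations

section SnapshotObject

variable {W : Type*}

/-- The contents of the snapshot object after the operation `e`, if they were `V` before. -/
def LinOp.effect (V : Fin n → Option W) (e : LinOp n W) : Fin n → Option W :=
  match e.op with
  | .update w => Function.update V e.proc (some w)
  | .scan => V

theorem SnapLegal.resp_eq_view {V : Fin n → Option W} {L₁ L₂ : List (LinOp n W)} {e : LinOp n W}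
    (h : SnapLegal V (L₁ ++ e :: L₂)) (he : e.op = .scan) :
    e.resp = .view (L₁.foldl LinOp.effect V) := by
  induction L₁ generalizing V with
  | nil =>
    simp only [List.nil_append, SnapLegal, he] at h
    exact h.1
  | cons f L ih =>
    rw [List.cons_append, SnapLegal] at h
    rw [List.foldl_cons, LinOp.effect]
    cases hf : f.op <;> rw [hf] at h <;> exact ih h.2

theorem foldl_effect_apply_of_forall_ne {V : Fin n → Option W} {L : List (LinOp n W)} {j : Fin n}
    (h : ∀ e ∈ L, e.proc = j → ∀ w, e.op ≠ .update w) : L.foldl LinOp.effect V j = V j := by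
  refine List.foldlRecOn (motive := fun V' : Fin n → Option W => V' j = V j) _ _ rfl
    fun V' hV' e he => ?_
  cases hop : e.op with
  | update w =>
    have hj : j ≠ e.proc := fun hj => h e he hj.symm w hop
    simpa only [LinOp.effect, hop, Function.update_of_ne hj] using hV'
  | scan => simpa only [LinOp.effect, hop] using hV'

theorem exists_update_of_foldl_effect_apply {V : Fin n → Option W} {L : List (LinOp n W)}
    {j : Fin n} {v : W} (h : L.foldl LinOp.effect V j = some v) (hV : V j ≠ some v) :
    ∃ e ∈ L, e.proc = j ∧ e.op = .update v := by
  by_contra! hno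
  refine List.foldlRecOn (motive := fun V' : Fin n → Option W => V' j ≠ some v) _ _ hV
    (fun V' hV' e he => ?_) h
  cases hop : e.op with
  | update w =>
    obtain rfl | hj := eq_or_ne e.proc j
    · have hw : w ≠ v := by
        rintro rfl
        exact hno e he rfl hop
      simpa only [LinOp.effect, hop, Function.update_self, ne_eq, Option.some_inj] using hw
    · simpa only [LinOp.effect, hop, Function.update_of_ne hj.symm] using hV'
  | scan => simpa only [LinOp.effect, hop] using hV'

namespace IsLinearization

variable {r : Run n Var Val Intl (SnapOp W) (SnapResp n W)} {T : ℕ} {L : List (LinOp n W)}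

theorem exists_mem (hL : IsLinearization r T L) {i : Fin n} {o : SnapOp W} {y : SnapResp n W}
    {t t' : ℕ} (h : r.OpBetween i o y t t') (ht : t' ≤ T) : ⟨i, t, o, y⟩ ∈ L := by
  obtain ⟨e, he, rfl, rfl⟩ := hL.completed i o y t t' h ht
  obtain rfl : e.op = o := Option.some_inj.1 ((hL.invoked e he).2.symm.trans h.1)
  obtain rfl := hL.response e he y t' h ht
  exact he

theorem exists_view_apply_ne (hL : IsLinearization r T L) {k j : Fin n} {v : W}
    {y : SnapResp n W} {t t' : ℕ} (h : r.OpBetween k .scan y t t') (ht : t' ≤ T)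
    (hv : ∀ s < T, (r.step s).inv j ≠ some (.update v)) :
    ∃ V, y = .view V ∧ V j ≠ some v := by
  obtain ⟨L₁, L₂, rfl⟩ := List.append_of_mem (hL.exists_mem h ht)
  refine ⟨_, hL.legal.resp_eq_view rfl, fun hV => ?_⟩
  obtain ⟨f, hf, rfl, hfo⟩ := exists_update_of_foldl_effect_apply hV nofun
  obtain ⟨hfT, hfinv⟩ := hL.invoked f (List.mem_append_left _ hf)
  exact hv _ hfT (hfo ▸ hfinv)

theorem exists_view_apply_eq (hL : IsLinearization r T L) {k j : Fin n} {v : W}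
    {y z : SnapResp n W} {t t' u u' : ℕ} (hscan : r.OpBetween k .scan y t t') (ht : t' ≤ T)
    (hupd : r.OpBetween j (.update v) z u u') (hu : u' ≤ T) (hut : u' < t)
    (hlast : ∀ s < T, ∀ w, (r.step s).inv j = some (.update w) → s ≤ u) :
    ∃ V, y = .view V ∧ V j = some v := by
  obtain ⟨L₁, L₂, rfl⟩ := List.append_of_mem (hL.exists_mem hscan ht)
  refine ⟨_, hL.legal.resp_eq_view rfl, ?_⟩
  have update_before : ⟨j, u, .update v, z⟩ ∈ L₁ := by
    obtain hmem | hmem := List.mem_append.1 (hL.exists_mem hupd hu)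
    · exact hmem
    obtain heq | hmem := List.mem_cons.1 hmem
    · cases heq
    · have order := (List.pairwise_cons.1 (List.pairwise_append.1 hL.realTime).2.1).1 _ hmem
      exact (order ⟨z, u', hupd, hu, hut⟩).elim
  obtain ⟨L₃, L₄, rfl⟩ := List.append_of_mem update_before
  rw [List.foldl_append, List.foldl_cons, foldl_effect_apply_of_forall_ne]
  · exact Function.update_self _ _ _
  · rintro e he rfl w hw
    obtain ⟨heT, heinv⟩ := hL.invoked e (by simp [he])
    have order := (List.pairwise_append.1 (List.pairwise_append.1 hL.procOrder).1).2.1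
    exact ((List.pairwise_cons.1 order).1 e he rfl).not_ge (hlast _ heT w (hw ▸ heinv))

end IsLinearization

end SnapshotObject

section LocalStates

theorem LocalState.not_pending_append_ret (l : LocalState Var Val Intl Op Resp) (y : Resp) :
    ¬ LocalState.Pending (l ++ [.ret y] : LocalState Var Val Intl Op Resp) := by
  rintro ⟨l₁, o, l₂, h, hl₂⟩
  obtain rfl | ⟨l₃, z, rfl⟩ := List.eq_nil_or_concat' l₂
  · simp at h
  · rw [← List.cons_append, ← List.append_assoc] at h
    obtain rfl : Rec.ret y = z := List.singleton_inj.1 (List.append_inj' h rfl).2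
    exact hl₂ y (by simp)

theorem LocalState.pending_append_invoke (l : LocalState Var Val Intl Op Resp) (o : Op) :
    LocalState.Pending (l ++ [.invoke o] : LocalState Var Val Intl Op Resp) :=
  ⟨l, o, [], rfl, fun _ => List.not_mem_nil⟩

end LocalStates

section SnapshotRuns

variable {W : Type*} {I : Implementation n Var Val Intl (SnapOp W) (SnapResp n W)}
  {r r' : Run n Var Val Intl (SnapOp W) (SnapResp n W)} {T : ℕ}
  {ms mu : List (Move n Var Val Intl (SnapOp W) (SnapResp n W))}
  {g : GlobalState n Var Val Intl (SnapOp W) (SnapResp n W)} {S : Set (Fin n)}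
  {j k : Fin n} {v : W} {y z : SnapResp n W}

/-- The operation `update_j(v)` is not invoked in the first `T` rounds of `r`. -/
def Run.Fresh (r : Run n Var Val Intl (SnapOp W) (SnapResp n W)) (T : ℕ) (j : Fin n) (v : W) :
    Prop :=
  ∀ t < T, (r.step t).inv j ≠ some (.update v)

/-- The process and the value of the update that the move invokes, if any. -/
def Move.update? : Move n Var Val Intl (SnapOp W) (SnapResp n W) → Option (Fin n × W)
  | .inv k (.update w) => some (k, w)
  | _ => none

/-- The processes and the values of the updates invoked in the course of the given moves. -/
def updates (ms : List (Move n Var Val Intl (SnapOp W) (SnapResp n W))) : List (Fin n × W) :=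
  ms.filterMap Move.update?

theorem updates_append (ms ms' : List (Move n Var Val Intl (SnapOp W) (SnapResp n W))) :
    updates (ms ++ ms') = updates ms ++ updates ms' :=
  List.filterMap_append

theorem updates_eq_nil (h : ∀ x ∈ ms, x.Quiet S) : updates ms = [] := by
  refine List.filterMap_eq_nil_iff.2 fun x hx => ?_
  cases x with
  | inv k o => exact ((h _ hx).2 k o rfl).elim
  | _ => rfl

theorem SoloBody.updates_soloOp (hms : SoloBody k ms) (o : SnapOp W) (y : SnapResp n W) :
    updates (soloOp k o ms y) =
      updates ([.inv k o] : List (Move n Var Val Intl (SnapOp W) (SnapResp n W))) := by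
  change updates ([.inv k o] ++ (ms ++ [.act k (.ret y)])) = _
  rw [updates_append, updates_append, updates_eq_nil fun x hx => (hms x hx).1]
  exact List.append_nil _

namespace Run.Continues

theorem exists_getElem_update? (h : Continues I r T ms g S r') {t : ℕ} (ht : T ≤ t)
    (hinv : (r'.step t).inv j = some (.update v)) :
    ∃ m, ∃ hm : m < ms.length, t = T + m ∧ ms[m].update? = some (j, v) := by
  obtain hlt | hge := lt_or_ge t (T + ms.length)
  · obtain ⟨m, rfl⟩ := Nat.exists_eq_add_of_le ht
    have hm : m < ms.length := by lia
    rw [h.moves m hm] at hinv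
    exact ⟨m, hm, rfl, by rw [Move.eq_inv_of_toJoint hinv]; rfl⟩
  · obtain ⟨x, hx, -, hquiet⟩ := h.tail t hge
    rw [hx] at hinv
    exact (hquiet.2 _ _ (Move.eq_inv_of_toJoint hinv)).elim

theorem mem_updates (h : Continues I r T ms g S r') {t : ℕ} (ht : T ≤ t)
    (hinv : (r'.step t).inv j = some (.update v)) : (j, v) ∈ updates ms := by
  obtain ⟨m, hm, -, hupd⟩ := h.exists_getElem_update? ht hinv
  exact List.mem_filterMap.2 ⟨_, List.getElem_mem hm, hupd⟩

theorem fresh (h : Continues I r T ms g S r') (hv : r.Fresh T j v) (hms : (j, v) ∉ updates ms)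
    (T' : ℕ) : r'.Fresh T' j v := by
  intro t _ hinv
  obtain ht | ht := lt_or_ge t T
  · exact hv t ht (by rwa [h.agree.step t ht] at hinv)
  · exact hms (h.mem_updates ht hinv)

theorem writeOnce (h : Continues I r T ms g S r') (hrw : r.WriteOnce)
    (hfresh : ∀ p w, (p, w) ∈ updates ms → r.Fresh T p w) (hnodup : (updates ms).Nodup) :
    r'.WriteOnce := by
  have never_lt : ∀ p w t t', (r'.step t).inv p = some (.update w) →
      (r'.step t').inv p = some (.update w) → ¬ t < t' := by
    intro p w t t' hinv hinv' htt
    obtain ht | ht := lt_or_ge t T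
    · rw [h.agree.step t ht] at hinv
      obtain ht' | ht' := lt_or_ge t' T
      · rw [h.agree.step t' ht'] at hinv'
        exact htt.ne (hrw p w t t' hinv hinv')
      · exact hfresh p w (h.mem_updates ht' hinv') t ht hinv
    · obtain ⟨m, hm, rfl, hupd⟩ := h.exists_getElem_update? ht hinv
      obtain ⟨m', hm', rfl, hupd'⟩ := h.exists_getElem_update? (ht.trans htt.le) hinv'
      have pairwise := List.pairwise_iff_getElem.1 (List.pairwise_filterMap.1 hnodup)
      exact pairwise m m' hm hm' (by lia) _ hupd _ hupd' rfl
  intro p w t t' hinv hinv'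
  exact le_antisymm (not_lt.1 (never_lt p w t' t hinv' hinv))
    (not_lt.1 (never_lt p w t t' hinv hinv'))

theorem writeOnce_of_updates_eq_nil (h : Continues I r T ms g S r') (hrw : r.WriteOnce)
    (hms : updates ms = []) : r'.WriteOnce :=
  h.writeOnce hrw (by simp [hms]) (by simp [hms])

theorem writeOnce_of_updates_eq_singleton (h : Continues I r T ms g S r') (hrw : r.WriteOnce)
    (hms : updates ms = [(j, v)]) (hv : r.Fresh T j v) : r'.WriteOnce :=
  h.writeOnce hrw (by rintro p w hpw; simp_all) (by simp [hms])

theorem fair (h : Continues I r T ms g Set.univ r') : r'.Fair I :=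
  ⟨h.dispatchFair, fun i => h.procFair i trivial⟩

end Run.Continues

theorem Linearizable.exists_view_apply_ne (hLin : Linearizable I) (hr : r.IsRunOf I)
    (hrw : r.WriteOnce) (hv : r.Fresh T j v) (he : Exec I (r.state T) (soloOp k .scan ms y) g)
    (hms : SoloBody k ms) : ∃ V, y = .view V ∧ V j ≠ some v := by
  obtain ⟨r', c⟩ := hr.exists_continues he Set.univ
  have no_updates : updates (soloOp k .scan ms y) = [] := hms.updates_soloOp .scan y
  obtain ⟨L, hL⟩ := hLin r' c.isRunOf (c.writeOnce_of_updates_eq_nil hrw no_updates) c.fair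
    (T + ms.length + 2)
  have hscan := c.opBetween (a := []) (List.append_nil _).symm hms
  exact hL.exists_view_apply_ne hscan le_rfl (c.fresh hv (by simp [no_updates]) _)

-- Real-time order is strict, so the idle round is needed to make the update precede the scan.
theorem Linearizable.exists_view_apply_eq (hLin : Linearizable I) (hr : r.IsRunOf I)
    (hrw : r.WriteOnce) (hv : r.Fresh T j v)
    (he : Exec I (r.state T) (soloOp j (.update v) mu z ++ .idle :: soloOp k .scan ms y) g)
    (hmu : SoloBody j mu) (hms : SoloBody k ms) : ∃ V, y = .view V ∧ V j = some v := by
  obtain ⟨r', c⟩ := hr.exists_continues he Set.univ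
  have one_update : updates (soloOp j (.update v) mu z ++ .idle :: soloOp k .scan ms y) =
      [(j, v)] := by
    rw [updates_append, hmu.updates_soloOp]
    exact congrArg _ (hms.updates_soloOp .scan y)
  have hrw' := c.writeOnce_of_updates_eq_singleton hrw one_update hv
  have hupd := c.opBetween (a := []) rfl hmu
  have hscan := c.opBetween (a := soloOp j (.update v) mu z ++ [.idle]) (o := .scan) (y := y)
    (c := []) (by simp) hms
  obtain ⟨L, hL⟩ := hLin r' c.isRunOf hrw' c.fair _
  simp only [List.length_append, length_soloOp, List.length_singleton, List.length_nil]
    at hupd hscan hL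
  refine hL.exists_view_apply_eq hscan le_rfl hupd (by lia) (by lia) fun s _ w hinv => ?_
  obtain hs | hs := lt_or_ge s T
  · exact hs.le
  · obtain rfl : w = v := by simpa [one_update] using c.mem_updates hs hinv
    exact (hrw' j w s _ hinv hupd.1).le

end SnapshotRuns

/-- No store buffer holds an item and no process has a pending operation: the states in which the
effect of a single update can be studied in isolation. -/
structure GlobalState.Quiescent (g : GlobalState n Var Val Intl Op Resp) : Prop where
  buf : ∀ p, g.tso.buf p = []
  not_pending : ∀ p, ¬ (g.loc p).Pending

section ObstructionFreedom

variable {W : Type*} {I : Implementation n Var Val Intl (SnapOp W) (SnapResp n W)}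
  {r : Run n Var Val Intl (SnapOp W) (SnapResp n W)} {T : ℕ} {j k : Fin n} {v : W}

namespace ObstructionFree

theorem exists_exec_ret (hOF : ObstructionFree I) (hr : r.IsRunOf I) (hrw : r.WriteOnce)
    (hk : ((r.state T).loc k).Pending) :
    ∃ ms y g, SoloBody k ms ∧ Exec I (r.state T) (ms ++ [.act k (.ret y)]) g := by
  classical
  obtain ⟨r', c⟩ := hr.exists_continues_nil T {k}
  have hT : r'.state T = r.state T := c.state_add_length
  have : Nonempty (Move n Var Val Intl (SnapOp W) (SnapResp n W)) := ⟨.idle⟩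
  choose! mv hstep hvalid hquiet using fun t (ht : T ≤ t) => c.tail t ht
  have exists_ret : ∃ m y, mv (T + m) = .act k (.ret y) := by
    obtain ⟨s, y, hs, hret⟩ := hOF r' c.isRunOf (c.writeOnce_of_updates_eq_nil hrw rfl)
      c.dispatchFair k (c.procFair k rfl) T (by rwa [hT]) fun s hs p hpk => by
        by_contra hact
        rw [hstep s hs] at hact
        have hby := (hquiet s hs).1
        rw [Move.eq_act_of_toJoint rfl hact] at hby
        exact hpk hby
    obtain ⟨m, rfl⟩ := Nat.exists_eq_add_of_le hs
    rw [hstep _ hs] at hret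
    exact ⟨m, y, Move.eq_act_of_toJoint hret nofun⟩
  obtain ⟨y, hy⟩ := Nat.find_spec exists_ret
  have he := c.isRunOf.exec_range_map (fun t ht => ⟨hstep t ht, hvalid t ht⟩)
    (Nat.find exists_ret + 1)
  rw [List.range_succ, List.map_append, List.map_singleton, hy, hT] at he
  refine ⟨_, y, _, fun x hx => ?_, he⟩
  obtain ⟨m, hm, rfl⟩ := List.mem_map.1 hx
  exact ⟨hquiet _ (Nat.le_add_right _ _),
    fun y' hy' => Nat.find_min exists_ret (List.mem_range.1 hm) ⟨y', hy'⟩⟩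

theorem exists_exec_soloOp (hOF : ObstructionFree I) (hr : r.IsRunOf I) (hrw : r.WriteOnce)
    (hk : ¬ ((r.state T).loc k).Pending) (o : SnapOp W)
    (hfresh : ∀ w, o = .update w → r.Fresh T k w) :
    ∃ ms y g, SoloBody k ms ∧ Exec I (r.state T) (soloOp k o ms y) g := by
  have hinv : (Move.inv k o).Valid I (r.state T) := hk
  obtain ⟨r', c⟩ := hr.exists_continues (Exec.single hinv) Set.univ
  have hrw' : r'.WriteOnce := by
    cases o with
    | update w => exact c.writeOnce_of_updates_eq_singleton hrw rfl (hfresh w rfl)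
    | scan => exact c.writeOnce_of_updates_eq_nil hrw rfl
  have hstate : r'.state (T + 1) = (Move.inv k o).apply (r.state T) := c.state_add_length
  have hpending : ((r'.state (T + 1)).loc k).Pending := by
    simpa only [hstate, Move.apply, Function.update_self] using
      LocalState.pending_append_invoke _ o
  obtain ⟨ms, y, g, hms, he⟩ := hOF.exists_exec_ret c.isRunOf hrw' hpending
  exact ⟨ms, y, g, hms, .cons hinv (hstate ▸ he)⟩

theorem exists_exec_not_pending (hOF : ObstructionFree I) (hr : r.IsRunOf I) (hrw : r.WriteOnce)
    (T : ℕ) (k : Fin n) :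
    ∃ ms g, Exec I (r.state T) ms g ∧ (∀ x ∈ ms, x.Quiet {k}) ∧ ¬ (g.loc k).Pending := by
  by_cases hk : ((r.state T).loc k).Pending
  · obtain ⟨ms, y, g, hms, he⟩ := hOF.exists_exec_ret hr hrw hk
    refine ⟨_, g, he, ?_, ?_⟩
    · simp only [List.forall_mem_append, List.forall_mem_singleton]
      exact ⟨fun x hx => (hms x hx).1, rfl, nofun⟩
    · obtain ⟨g', -, hret⟩ := he.exists_of_append
      obtain _ | ⟨-, _ | _⟩ := hret
      simpa only [Move.apply, Function.update_self, MemState.record] using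
        LocalState.not_pending_append_ret _ y
  · exact ⟨[], _, .nil _, List.forall_mem_nil _, hk⟩

theorem exists_exec_forall_not_pending (hOF : ObstructionFree I) (hr : r.IsRunOf I)
    (hrw : r.WriteOnce) (T : ℕ) :
    ∃ ms g, Exec I (r.state T) ms g ∧ updates ms = [] ∧ ∀ p, ¬ (g.loc p).Pending := by
  suffices ∀ s : Finset (Fin n), ∃ ms g, Exec I (r.state T) ms g ∧ updates ms = [] ∧
      ∀ p ∈ s, ¬ (g.loc p).Pending by simpa using this Finset.univ
  intro s
  induction s using Finset.induction_on with
  | empty => exact ⟨[], _, .nil _, rfl, nofun⟩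
  | insert k s _ ih =>
    obtain ⟨ms, g, he, hms, hs⟩ := ih
    obtain ⟨r', c⟩ := hr.exists_continues he Set.univ
    obtain ⟨ms', g', he', hms', hk⟩ := hOF.exists_exec_not_pending c.isRunOf
      (c.writeOnce_of_updates_eq_nil hrw hms) (T + ms.length) k
    rw [c.state_add_length] at he'
    refine ⟨_, g', he.append he', ?_, fun p hp => ?_⟩
    · rw [updates_append, hms, updates_eq_nil hms', List.append_nil]
    · obtain rfl | hpk := eq_or_ne p k
      · exact hk
      · rw [he'.loc_of_ne hpk fun x hx => (hms' x hx).1]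
        exact hs p (Finset.mem_of_mem_insert_of_ne hp hpk)

theorem exists_exec_quiescent (hOF : ObstructionFree I) (hr : r.IsRunOf I) (hrw : r.WriteOnce)
    (T : ℕ) : ∃ ms g, Exec I (r.state T) ms g ∧ updates ms = [] ∧ g.Quiescent := by
  obtain ⟨ms, g, he, hms, hg⟩ := hOF.exists_exec_forall_not_pending hr hrw T
  obtain ⟨ms', g', he', hms', hloc, hbuf⟩ := Exec.exists_flush I g
  exact ⟨_, g', he.append he', by rw [updates_append, hms, updates_eq_nil hms', List.append_nil],
    hbuf, fun p => hloc ▸ hg p⟩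

end ObstructionFree

theorem exists_isSync_of_exec_update (hOF : ObstructionFree I) (hLin : Linearizable I)
    (hr : r.IsRunOf I) (hrw : r.WriteOnce) (hv : r.Fresh T j v) (hT : (r.state T).Quiescent)
    (hkj : k ≠ j) {mu : List (Move n Var Val Intl (SnapOp W) (SnapResp n W))} {z : SnapResp n W}
    {g : GlobalState n Var Val Intl (SnapOp W) (SnapResp n W)} (hmu : SoloBody j mu)
    (he : Exec I (r.state T) (soloOp j (.update v) mu z) g) :
    ∃ p a, .act p a ∈ mu ∧ a.IsSync := by
  by_contra! hsync
  obtain ⟨ms, y, g', hms, hscan⟩ :=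
    hOF.exists_exec_soloOp hr hrw (hT.not_pending k) .scan nofun
  obtain ⟨V, rfl, hne⟩ := hLin.exists_view_apply_ne hr hrw hv hscan hms
  obtain ⟨mu', g₁, g₂, hmu', hhidden, hscan'⟩ :=
    hmu.exists_hidden_op hms hkj hT.buf hsync he hscan
  have hboth := hhidden.append (.cons (x := .idle) trivial hscan')
  obtain ⟨V', hVV', heq⟩ := hLin.exists_view_apply_eq hr hrw hv hboth hmu' hms
  cases hVV'
  exact hne heq

end ObstructionFreedom

end TSO

theorem mainTheorem9_general {n : ℕ} (hn : 2 ≤ n) {W Var Val Intl : Type*}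
    (I : TSO.Implementation n Var Val Intl (TSO.SnapOp W) (TSO.SnapResp n W))
    (hOF : TSO.ObstructionFree I) (hLin : TSO.Linearizable I)
    (r : TSO.Run n Var Val Intl (TSO.SnapOp W) (TSO.SnapResp n W))
    (hr : r.IsRunOf I) (hrw : r.WriteOnce) (T : ℕ) (j : Fin n) (v : W) (hv : r.Fresh T j v) :
    ∃ r' : TSO.Run n Var Val Intl (TSO.SnapOp W) (TSO.SnapResp n W),
      r'.IsRunOf I ∧ r'.WriteOnce ∧ r'.Fair I ∧ r.AgreesUpTo r' T ∧
      ∃ (z : TSO.SnapResp n W) (us ue : ℕ),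
        T < us ∧ r'.OpBetween j (TSO.SnapOp.update v) z us ue ∧ r'.ContainsSync j us ue := by
  have : Nontrivial (Fin n) := Fin.nontrivial_iff_two_le.2 hn
  obtain ⟨k, hkj⟩ := exists_ne j
  obtain ⟨ms, g, he, hms, hg⟩ := hOF.exists_exec_quiescent hr hrw T
  obtain ⟨r₁, c₁⟩ := hr.exists_continues (he.cons (x := .idle) trivial) Set.univ
  have no_updates : TSO.updates (.idle :: ms) = [] := hms
  have hrw₁ := c₁.writeOnce_of_updates_eq_nil hrw no_updates
  have hv₁ := c₁.fresh hv (by simp [no_updates]) (T + (ms.length + 1))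
  rw [← c₁.state_add_length] at hg
  obtain ⟨mu, z, _, hmu, hupd⟩ := hOF.exists_exec_soloOp c₁.isRunOf hrw₁ (hg.not_pending j)
    (.update v) (by rintro w ⟨⟩; exact hv₁)
  obtain ⟨p, a, ha, hsync⟩ :=
    TSO.exists_isSync_of_exec_update hOF hLin c₁.isRunOf hrw₁ hv₁ hg hkj hmu hupd
  obtain ⟨r₂, c₂⟩ := c₁.isRunOf.exists_continues hupd Set.univ
  have is_soloOp := (List.append_nil (TSO.soloOp j (.update v) mu z)).symm
  exact ⟨r₂, c₂.isRunOf,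
    c₂.writeOnce_of_updates_eq_singleton hrw₁ (hmu.updates_soloOp (.update v) z) hv₁, c₂.fair,
    c₁.agree.trans c₂.agree (Nat.le_add_right _ _), z, T + (ms.length + 1), _, by lia,
    c₂.opBetween (a := []) is_soloOp hmu, c₂.containsSync (a := []) is_soloOp hmu ha hsync⟩

theorem mainTheorem9 {n : ℕ} (hn : 2 ≤ n) {W Var Val Intl : Type*} [Finite Var]
    (I : TSO.Implementation n Var Val Intl (TSO.SnapOp W) (TSO.SnapResp n W))
    (hOF : TSO.ObstructionFree I) (hLin : TSO.Linearizable I)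
    (r : TSO.Run n Var Val Intl (TSO.SnapOp W) (TSO.SnapResp n W))
    (hr : r.IsRunOf I) (hrw : r.WriteOnce)
    (i : Fin n) (y : TSO.SnapResp n W) (ts te : ℕ)
    (hscan : r.OpBetween i TSO.SnapOp.scan y ts te)
    (hsolo : r.Solo i ts te) (hsync : ¬ r.ContainsSync i ts te)
    (j : Fin n) (v : W)
    (hv : ∀ t, t < te → (r.step t).inv j ≠ some (TSO.SnapOp.update v)) :
    ∃ r' : TSO.Run n Var Val Intl (TSO.SnapOp W) (TSO.SnapResp n W),
      r'.IsRunOf I ∧ r'.WriteOnce ∧ r'.Fair I ∧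
      (∀ t, t ≤ te → (r'.state t).loc i = (r.state t).loc i) ∧
      r'.OpBetween i TSO.SnapOp.scan y ts te ∧
      ∃ (z : TSO.SnapResp n W) (us ue : ℕ),
        te < us ∧ r'.OpBetween j (TSO.SnapOp.update v) z us ue ∧ r'.ContainsSync j us ue := by
  obtain ⟨r', hr', hrw', hfair, hagree, hupd⟩ :=
    mainTheorem9_general hn I hOF hLin r hr hrw te j v hv
  exact ⟨r', hr', hrw', hfair, fun t ht => by rw [hagree.state t ht],
    hagree.opBetween hscan le_rfl, hupd⟩
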